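/- Let $G$ be a finite simple undirected graph of order $n\ge 8$ that is $2$-connected, and let $\rho(G)$ be its spectral radius, i.e. the largest eigenvalue of its adjacency matrix. If $$\rho(G)\;\ge\; n-4+\frac{2}{n-4},$$ then $G$ contains a homeomorphically irreducible spanning tree (HIST), i.e. a spanning tree that has no vertex of degree $2$. -/

import Mathlib

open Classical in
/-- The spectral radius `ρ(G)` of a finite graph: the largest (real) eigenvalue of its adjacency
matrix. The set of eigenvalues is finite, and non-empty as soon as `G` has a vertex, so the
supremum is then a maximum (see `SimpleGraph.isGreatest_specRadius`). -/
noncomputable def SimpleGraph.specRadius {V : Type*} [Fintype V] (G : SimpleGraph V) : ℝ :=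
  sSup {μ : ℝ | Module.End.HasEigenvalue (Matrix.toLin' (G.adjMatrix ℝ)) μ}

open Classical in
/-- On a non-empty vertex set the spectral radius is an eigenvalue of the adjacency matrix and it is
the largest one. -/
theorem SimpleGraph.isGreatest_specRadius {V : Type*} [Fintype V] [Nonempty V]
    (G : SimpleGraph V) :
    IsGreatest {μ : ℝ | Module.End.HasEigenvalue (Matrix.toLin' (G.adjMatrix ℝ)) μ}
      G.specRadius := by
  have hA : (G.adjMatrix ℝ).IsHermitian := G.isHermitian_adjMatrix ℝ
  have hset : {μ : ℝ | Module.End.HasEigenvalue (Matrix.toLin' (G.adjMatrix ℝ)) μ}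
      = Set.range hA.eigenvalues := by
    rw [← hA.spectrum_real_eq_range_eigenvalues, ← Matrix.spectrum_toLin']
    ext μ
    exact Module.End.hasEigenvalue_iff_mem_spectrum
  unfold SimpleGraph.specRadius
  rw [hset]
  have hne : (Set.range hA.eigenvalues).Nonempty := Set.range_nonempty _
  have hfin : (Set.range hA.eigenvalues).Finite := Set.finite_range _
  exact ⟨hne.csSup_mem hfin, fun _ hx => le_csSup hfin.bddAbove hx⟩

/-- A finite graph is `k`-connected if it has more than `k` vertices and stays connected
whenever fewer than `k` vertices are removed. -/
def SimpleGraph.IsKConnected {V : Type*} [Fintype V] (G : SimpleGraph V) (k : ℕ) : Prop :=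
  k < Fintype.card V ∧
    ∀ S : Finset V, S.card < k → (G.induce {v : V | v ∉ S}).Connected

/-- `T` is a homeomorphically irreducible spanning tree (HIST) of `G`: a tree on the whole vertex
set of `G` all of whose edges are edges of `G`, and which has no vertex of degree `2`. -/
def SimpleGraph.IsHIST {V : Type*} (G T : SimpleGraph V) : Prop :=
  T ≤ G ∧ T.IsTree ∧ ∀ v : V, (T.neighborSet v).ncard ≠ 2

/-! Write `s = n - 3`, so the hypothesis is `ρ ≥ s - 1 + 2/(s - 1)`. Pairing a nonnegative
eigenvector with the row sums of `A² - A` gives a vertex `v` whose row sum, the sum of `deg w - 1`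
over its neighbours `w`, is at least `ρ² - ρ > s² - 3s + 5`. By integrality it is at least `s² - 3s
+ 6`. Two facts follow: some vertex has degree at least `s`, and, since 2-connectedness forces
minimum degree two, the degree sum is at least `s² - s + 10`.

Let `u` have maximum degree; it has at most two non-neighbours. A HIST is sought that is a star at
`u` with a few vertices rehung: a vertex not adjacent to `u` is hung below another vertex together
with a companion, so that no vertex of degree 2 arises. Depth at most 3 suffices. With no
non-neighbour the star works. With one non-neighbour `w`, a neighbour of `w` of degree at least 3
gives a double star.

With two non-neighbours `w₁`, `w₂`, three shapes are available: both below one vertex, two separate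
brooms, or, if `w₁` and `w₂` are adjacent, one below the other. If all the shapes available in a
case are missing, the neighbours of `w₁` and `w₂` have very few neighbours inside `N(u)`, and the
degree sum drops below `s² - s + 10`. Several of these counts miss the threshold by exactly one. -/

namespace SimpleGraph

/-! ### HISTs from parent functions -/

/-- A parent function `p` with root `r` along edges of `G`, in which every vertex has depth at
most `3`, the root has at least three children, and a vertex with one child has a second one,
yields a HIST. -/
theorem exists_isHIST_of_parent {V : Type*} [Fintype V] (G : SimpleGraph V) (r : V) (p : V → V)
    (hr : p r = r) (hp : ∀ v, p (p (p v)) = r) (hadj : ∀ v, v ≠ r → G.Adj v (p v))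
    (hroot : ∃ c₁ c₂ c₃, c₁ ≠ c₂ ∧ c₁ ≠ c₃ ∧ c₂ ≠ c₃ ∧
      (c₁ ≠ r ∧ p c₁ = r) ∧ (c₂ ≠ r ∧ p c₂ = r) ∧ (c₃ ≠ r ∧ p c₃ = r))
    (hchild : ∀ c, p c ≠ r → ∃ c', c' ≠ c ∧ p c' = p c) :
    ∃ T : SimpleGraph V, G.IsHIST T := by
  classical
  let T : SimpleGraph V := SimpleGraph.fromRel (fun v w => v ≠ r ∧ p v = w)
  have hT : ∀ v w, T.Adj v w ↔ (v ≠ r ∧ p v = w) ∨ (w ≠ r ∧ p w = v) := by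
    intro v w
    simp only [T, SimpleGraph.fromRel_adj]
    constructor
    · rintro ⟨-, h⟩
      exact h
    · rintro (⟨h1, rfl⟩ | ⟨h1, rfl⟩)
      · exact ⟨(hadj _ h1).ne, Or.inl ⟨h1, rfl⟩⟩
      · exact ⟨(hadj _ h1).ne', Or.inr ⟨h1, rfl⟩⟩
  have hstep : ∀ v, T.Reachable v (p v) := by
    intro v
    by_cases hv : v = r
    · subst hv
      rw [hr]
    · exact ((hT _ _).2 (Or.inl ⟨hv, rfl⟩)).reachable
  have hreach : ∀ v, T.Reachable v r := by
    intro v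
    have h := ((hstep v).trans (hstep _)).trans (hstep _)
    rwa [hp] at h
  have hconn : T.Connected :=
    { preconnected := fun v w => (hreach v).trans (hreach w).symm
      nonempty := ⟨r⟩ }
  -- A 2-cycle of `p` would never reach the root; hence the parent of a vertex differs from each of
  -- its children.
  have hnofix : ∀ v, v ≠ r → p (p v) = v → False := by
    intro v hv h
    have h3 := hp v
    rw [h] at h3
    have h4 := hp (p v)
    rw [h, h3, hr] at h4
    exact hv (by rw [← h, h3, hr])
  refine ⟨T, ?_, ?_, ?_⟩
  · intro v w h
    rcases (hT v w).1 h with ⟨h1, rfl⟩ | ⟨h1, rfl⟩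
    · exact hadj _ h1
    · exact (hadj _ h1).symm
  · rw [SimpleGraph.isTree_iff_connected_and_card]
    refine ⟨hconn, ?_⟩
    have hle := hconn.card_vert_le_card_edgeSet_add_one
    -- Connectedness gives one inequality; for the other, `v ↦ s(v, p v)` maps the non-root vertices
    -- onto the edges.
    refine le_antisymm ?_ hle
    have hsub : T.edgeSet ⊆ (fun v => s(v, p v)) '' {v | v ≠ r} := by
      intro e
      induction e with
      | _ v w =>
        intro h
        rcases (hT v w).1 h with ⟨h1, rfl⟩ | ⟨h1, rfl⟩
        · exact ⟨v, h1, rfl⟩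
        · exact ⟨w, h1, Sym2.eq_swap⟩
    have h1 : Nat.card T.edgeSet ≤ ({v | v ≠ r} : Set V).ncard := by
      rw [Nat.card_coe_set_eq]
      exact (Set.ncard_le_ncard hsub (Set.toFinite _)).trans (Set.ncard_image_le (Set.toFinite _))
    have h2 : ({v | v ≠ r} : Set V).ncard + 1 = Nat.card V := by
      have h3 := Set.ncard_add_ncard_compl ({r} : Set V)
      rw [Set.ncard_singleton] at h3
      rw [← h3, add_comm]
      rfl
    omega
  · intro v
    have three : ∀ a b c : V, a ≠ b → a ≠ c → b ≠ c → T.Adj v a → T.Adj v b → T.Adj v c →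
        (T.neighborSet v).ncard ≠ 2 := by
      intro a b c hab hac hbc ha hb hc h2
      have hsub : ({a, b, c} : Set V) ⊆ T.neighborSet v := by
        rintro x (rfl | rfl | rfl) <;> assumption
      have := Set.ncard_le_ncard hsub (Set.toFinite _)
      rw [Set.ncard_eq_three.2 ⟨a, b, c, hab, hac, hbc, rfl⟩] at this
      omega
    by_cases hv : v = r
    · subst hv
      obtain ⟨a, b, c, hab, hac, hbc, ha, hb, hc⟩ := hroot
      exact three a b c hab hac hbc ((hT _ _).2 (Or.inr ha)) ((hT _ _).2 (Or.inr hb))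
        ((hT _ _).2 (Or.inr hc))
    · by_cases hc : ∃ c, p c = v
      · obtain ⟨c, rfl⟩ := hc
        obtain ⟨c', hne, hc'⟩ := hchild c hv
        have hcr : c ≠ r := fun h => hv (by rw [h, hr])
        have hcr' : c' ≠ r := fun h => hv (by rw [← hc', h, hr])
        refine three (p (p c)) c c' ?_ ?_ hne.symm ((hT _ _).2 (Or.inl ⟨hv, rfl⟩))
          ((hT _ _).2 (Or.inr ⟨hcr, rfl⟩)) ((hT _ _).2 (Or.inr ⟨hcr', hc'⟩))
        · exact fun h => hnofix c hcr h
        · intro h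
          exact hnofix c' hcr' (by rw [hc', h])
      · have : T.neighborSet v = {p v} := by
          ext w
          rw [SimpleGraph.mem_neighborSet, hT, Set.mem_singleton_iff]
          constructor
          · rintro (⟨-, h⟩ | ⟨-, h⟩)
            · exact h.symm
            · exact absurd ⟨w, h⟩ hc
          · rintro rfl
            exact Or.inl ⟨hv, rfl⟩
        rw [this, Set.ncard_singleton]
        norm_num

/-! ### The spectral bound -/

open Classical in
/-- The largest adjacency eigenvalue has a nonnegative eigenvector. -/
theorem exists_nonneg_eigenvector {V : Type*} [Fintype V] [Nonempty V] (G : SimpleGraph V) :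
    ∃ y : V → ℝ, y ≠ 0 ∧ (∀ v, 0 ≤ y v) ∧
      Matrix.mulVec (G.adjMatrix ℝ) y = G.specRadius • y := by
  set A := G.adjMatrix ℝ with hAdef
  have hA : A.IsHermitian := G.isHermitian_adjMatrix ℝ
  obtain ⟨hmem, hub⟩ := G.isGreatest_specRadius
  set ρ := G.specRadius
  obtain ⟨x, hx⟩ := hmem.exists_hasEigenvector
  have hxA : Matrix.mulVec A x = ρ • x := by
    have := hx.apply_eq_smul
    rwa [Matrix.toLin'_apply] at this
  have hHer : (ρ • (1 : Matrix V V ℝ) - A).IsHermitian := by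
    refine Matrix.IsHermitian.sub ?_ hA
    rw [Matrix.IsHermitian, Matrix.conjTranspose_smul]
    simp
  -- An eigenvalue `μ` of `ρ - A` makes `ρ - μ` an eigenvalue of `A`, and `ρ` is the largest one.
  have hpsd : (ρ • (1 : Matrix V V ℝ) - A).PosSemidef := by
    rw [hHer.posSemidef_iff_eigenvalues_nonneg]
    intro i
    have hv := hHer.mulVec_eigenvectorBasis i
    set v := hHer.eigenvectorBasis i
    set μ := hHer.eigenvalues i
    have hv0 : (v : V → ℝ) ≠ 0 := by
      intro h0
      have h1 : v ≠ 0 := hHer.eigenvectorBasis.orthonormal.ne_zero i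
      exact h1 (by ext j; exact congrFun h0 j)
    have hAv : Matrix.mulVec A v = (ρ - μ) • (v : V → ℝ) := by
      rw [Matrix.sub_mulVec, Matrix.smul_mulVec, Matrix.one_mulVec] at hv
      rw [sub_smul, ← hv]
      abel
    have := hub (show ρ - μ ∈ _ from
      Module.End.hasEigenvalue_of_hasEigenvector (x := (v : V → ℝ))
        (Module.End.hasEigenvector_iff.2 ⟨Module.End.mem_eigenspace_iff.2 (by
          rw [Matrix.toLin'_apply]; exact hAv), hv0⟩))
    show 0 ≤ μ
    linarith
  refine ⟨fun v => |x v|, ?_, fun v => abs_nonneg _, ?_⟩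
  · intro h
    apply hx.2
    ext v
    exact abs_eq_zero.1 (congrFun h v)
  · have hle : x ⬝ᵥ Matrix.mulVec A x ≤ (fun v => |x v|) ⬝ᵥ Matrix.mulVec A (fun v => |x v|) := by
      simp only [dotProduct, Matrix.mulVec, Finset.mul_sum]
      refine Finset.sum_le_sum fun i _ => Finset.sum_le_sum fun j _ => ?_
      have h0 : 0 ≤ A i j := by
        rw [hAdef, SimpleGraph.adjMatrix_apply]
        split_ifs <;> norm_num
      calc x i * (A i j * x j) ≤ |x i * (A i j * x j)| := le_abs_self _
        _ = _ := by rw [abs_mul, abs_mul, abs_of_nonneg h0]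
    have hsq : (fun v => |x v|) ⬝ᵥ (fun v => |x v|) = x ⬝ᵥ x := by
      simp [dotProduct]
    -- Taking absolute values keeps the norm and does not lower the quadratic form of `A`, so `|x|`
    -- is a zero of a positive semidefinite form and therefore lies in its kernel.
    have hz : star (fun v => |x v|) ⬝ᵥ
        Matrix.mulVec (ρ • (1 : Matrix V V ℝ) - A) (fun v => |x v|) = 0 := by
      refine le_antisymm ?_ (hpsd.dotProduct_mulVec_nonneg _)
      rw [star_trivial, Matrix.sub_mulVec, Matrix.smul_mulVec, Matrix.one_mulVec, dotProduct_sub,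
        dotProduct_smul, hsq]
      rw [hxA, dotProduct_smul] at hle
      linarith
    rw [hpsd.dotProduct_mulVec_zero_iff, Matrix.sub_mulVec, Matrix.smul_mulVec,
      Matrix.one_mulVec] at hz
    exact (sub_eq_zero.1 hz).symm

open Classical in
/-- The quantity `ρ² - ρ` is at most some row sum of `A² - A`. -/
theorem exists_specRadius_sq_sub_le {V : Type*} [Fintype V] [Nonempty V] (G : SimpleGraph V) :
    ∃ v, G.specRadius ^ 2 - G.specRadius ≤
      ∑ w ∈ G.neighborFinset v, ((G.degree w : ℝ) - 1) := by
  obtain ⟨y, hy0, hy, hAy⟩ := G.exists_nonneg_eigenvector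
  set ρ := G.specRadius
  set R : V → ℝ := fun v => ∑ w ∈ G.neighborFinset v, ((G.degree w : ℝ) - 1)
  have hrow : ∀ v, ∑ w ∈ G.neighborFinset v, y w = ρ * y v := by
    intro v
    have := congrFun hAy v
    rwa [SimpleGraph.adjMatrix_mulVec_apply] at this
  -- Symmetry of `A`: `yᵀ A f = (A y)ᵀ f = ρ yᵀ f`. Using it with `f = deg - 1` and with `f = 1`
  -- shows that the `y`-weighted average of the row sums is exactly `ρ² - ρ`.
  have hswap : ∀ f : V → ℝ, ∑ v, y v * ∑ w ∈ G.neighborFinset v, f w = ρ * ∑ v, y v * f v := by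
    intro f
    have h1 : ∑ v, y v * ∑ w ∈ G.neighborFinset v, f w
        = ∑ w, ∑ v ∈ G.neighborFinset w, y v * f w := by
      simp_rw [Finset.mul_sum]
      refine Finset.sum_comm' ?_
      intro v w
      simp [G.adj_comm]
    rw [h1, Finset.mul_sum]
    refine Finset.sum_congr rfl fun w _ => ?_
    rw [← Finset.sum_mul, hrow, mul_assoc]
  have hdeg : ∑ v, y v * (G.degree v : ℝ) = ρ * ∑ v, y v := by
    have := hswap (fun _ => 1)
    simpa using this
  have htot : ∑ v, y v * R v = (ρ ^ 2 - ρ) * ∑ v, y v := by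
    rw [hswap]
    simp only [mul_sub, mul_one, Finset.sum_sub_distrib]
    rw [hdeg]
    ring
  have hpos : 0 < ∑ v, y v := by
    refine lt_of_le_of_ne (Finset.sum_nonneg fun v _ => hy v) fun h => hy0 ?_
    ext v
    exact (Finset.sum_eq_zero_iff_of_nonneg fun v _ => hy v).1 h.symm v (Finset.mem_univ v)
  by_contra! hcon
  have hlt : ∑ v, y v * R v < ∑ v, y v * (ρ ^ 2 - ρ) := by
    obtain ⟨v, hv, hvpos⟩ := Finset.exists_lt_of_sum_lt
      (s := Finset.univ) (f := fun _ : V => (0 : ℝ)) (g := y) (by simpa using hpos)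
    exact Finset.sum_lt_sum (fun w _ => mul_le_mul_of_nonneg_left (hcon w).le (hy w))
      ⟨v, hv, mul_lt_mul_of_pos_left (hcon v) hvpos⟩
  rw [htot, ← Finset.sum_mul, mul_comm] at hlt
  exact lt_irrefl _ hlt

/-! ### Minimum degree and explicit trees -/

theorem IsKConnected.exists_two_neighbors {V : Type*} [Fintype V] {G : SimpleGraph V}
    (hG : G.IsKConnected 2) (v : V) : ∃ x y, x ≠ y ∧ G.Adj v x ∧ G.Adj v y := by
  classical
  obtain ⟨hcard, hG⟩ := hG
  have key : ∀ S : Finset V, S.card < 2 → v ∉ S → ∃ y, y ∉ S ∧ G.Adj v y := by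
    intro S hS hv
    have hconn := hG S hS
    obtain ⟨z, hz⟩ : ∃ z, z ∉ insert v S := by
      by_contra! h
      have h1 : Finset.univ ⊆ insert v S := fun z _ => h z
      have h2 := Finset.card_le_card h1
      have h3 := Finset.card_insert_le v S
      rw [Finset.card_univ] at h2
      omega
    rw [Finset.mem_insert, not_or] at hz
    have : Nontrivial {v : V | v ∉ S} :=
      ⟨⟨⟨v, hv⟩, ⟨z, hz.2⟩, fun h => hz.1 (congrArg Subtype.val h).symm⟩⟩
    obtain ⟨y, hy⟩ := hconn.preconnected.exists_adj_of_nontrivial ⟨v, hv⟩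
    exact ⟨y, y.2, hy⟩
  -- Deleting nothing yields one neighbour `x`; deleting `x` yields a second.
  obtain ⟨x, -, hx⟩ := key ∅ (by simp) (by simp)
  obtain ⟨y, hy, hy'⟩ := key {x} (by simp) (by simpa using hx.ne)
  exact ⟨x, y, fun h => hy (by simp [h]), hx, hy'⟩

/-- Supplies three children of the root. The trees below exclude at most five vertices (the root and
the rehung ones), so order eight is enough. -/
theorem exists_three_notMem {V : Type*} [Fintype V] [DecidableEq V] (F : Finset V)
    (h : F.card + 3 ≤ Fintype.card V) :
    ∃ a b c, a ≠ b ∧ a ≠ c ∧ b ≠ c ∧ a ∉ F ∧ b ∉ F ∧ c ∉ F := by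
  have h1 : 2 < Fᶜ.card := by
    rw [Finset.card_compl]
    omega
  obtain ⟨a, ha, b, hb, c, hc, hab, hac, hbc⟩ := Finset.two_lt_card.1 h1
  rw [Finset.mem_compl] at ha hb hc
  exact ⟨a, b, c, hab, hac, hbc, ha, hb, hc⟩

theorem exists_isHIST_of_star {V : Type*} [Fintype V] (G : SimpleGraph V)
    (hV : 8 ≤ Fintype.card V) (u : V) (hu : ∀ z, z ≠ u → G.Adj u z) :
    ∃ T : SimpleGraph V, G.IsHIST T := by
  classical
  obtain ⟨a, b, c, hab, hac, hbc, ha, hb, hc⟩ := exists_three_notMem ({u} : Finset V) (by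
    rw [Finset.card_singleton]
    omega)
  rw [Finset.mem_singleton] at ha hb hc
  exact G.exists_isHIST_of_parent u (fun _ => u) rfl (fun _ => rfl) (fun v hv => (hu v hv).symm)
    ⟨a, b, c, hab, hac, hbc, ⟨ha, rfl⟩, ⟨hb, rfl⟩, ⟨hc, rfl⟩⟩ (fun c h => absurd rfl h)

/-- The tree with root `u` in which `w` and `x` hang below `v` and all else below `u`. -/
theorem exists_isHIST_of_double_star {V : Type*} [Fintype V] (G : SimpleGraph V)
    (hV : 8 ≤ Fintype.card V) (u v w x : V) (huv : G.Adj u v) (hvw : G.Adj v w) (hvx : G.Adj v x)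
    (hwx : w ≠ x) (hw : w ≠ u) (hx : x ≠ u)
    (hu : ∀ z, z ≠ u → z ≠ w → z ≠ x → G.Adj u z) :
    ∃ T : SimpleGraph V, G.IsHIST T := by
  classical
  obtain ⟨a, b, c, hab, hac, hbc, ha, hb, hc⟩ := exists_three_notMem ({u, w, x} : Finset V) (by
    have := Finset.card_le_three (a := u) (b := w) (c := x)
    omega)
  simp only [Finset.mem_insert, Finset.mem_singleton, not_or] at ha hb hc
  have h1 := huv.ne
  have h2 := hvw.ne
  have h3 := hvx.ne
  refine G.exists_isHIST_of_parent u (fun z => if z = w ∨ z = x then v else u) ?_ ?_ ?_ ?_ ?_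
  · grind
  · grind
  · intro z hz
    split_ifs with h
    · rcases h with rfl | rfl
      · exact hvw.symm
      · exact hvx.symm
    · rw [not_or] at h
      exact (hu z hz h.1 h.2).symm
  · exact ⟨a, b, c, hab, hac, hbc, by grind, by grind, by grind⟩
  · intro z hz
    by_cases hzw : z = w
    · exact ⟨x, by grind⟩
    · exact ⟨w, by grind⟩

/-- The tree with root `u` in which `w₁, x₁` hang below `v₁`, and `w₂, x₂` below `v₂`, and all else
below `u`. -/
theorem exists_isHIST_of_two_brooms {V : Type*} [Fintype V] (G : SimpleGraph V)
    (hV : 8 ≤ Fintype.card V) (u v₁ w₁ x₁ v₂ w₂ x₂ : V)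
    (hvw₁ : G.Adj v₁ w₁) (hvx₁ : G.Adj v₁ x₁)
    (hvw₂ : G.Adj v₂ w₂) (hvx₂ : G.Adj v₂ x₂)
    (hnd : [u, v₁, v₂, w₁, w₂, x₁].Nodup) (hnd' : [u, v₁, v₂, w₁, w₂, x₂].Nodup) (hx : x₁ ≠ x₂)
    (hu : ∀ z, z ≠ u → z ≠ w₁ → z ≠ w₂ → G.Adj u z) :
    ∃ T : SimpleGraph V, G.IsHIST T := by
  classical
  obtain ⟨a, b, c, hab, hac, hbc, ha, hb, hc⟩ :=
    exists_three_notMem ({u, w₁, x₁, w₂, x₂} : Finset V) (by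
      have := Finset.card_le_five (a := u) (b := w₁) (c := x₁) (d := w₂) (e := x₂)
      omega)
  simp only [Finset.mem_insert, Finset.mem_singleton, not_or] at ha hb hc
  simp only [List.nodup_cons, List.mem_cons, List.not_mem_nil, or_false, not_or] at hnd hnd'
  refine G.exists_isHIST_of_parent u
    (fun z => if z = w₁ ∨ z = x₁ then v₁ else if z = w₂ ∨ z = x₂ then v₂ else u) ?_ ?_ ?_ ?_ ?_
  · grind
  · grind
  · intro z hz
    split_ifs with h h'
    · rcases h with rfl | rfl
      · exact hvw₁.symm
      · exact hvx₁.symm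
    · rcases h' with rfl | rfl
      · exact hvw₂.symm
      · exact hvx₂.symm
    · rw [not_or] at h h'
      exact (hu z hz h.1 h'.1).symm
  · exact ⟨a, b, c, hab, hac, hbc, by grind, by grind, by grind⟩
  · intro z hz
    by_cases h1 : z = w₁
    · exact ⟨x₁, by grind⟩
    · by_cases h2 : z = x₁
      · exact ⟨w₁, by grind⟩
      · by_cases h3 : z = w₂
        · exact ⟨x₂, by grind⟩
        · exact ⟨w₂, by grind⟩

/-- The tree with root `u` in which `w₁, x` hang below `v`, and `w₂, y` below `w₁`, and all else
below `u`. -/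
theorem exists_isHIST_of_deep_broom {V : Type*} [Fintype V] (G : SimpleGraph V)
    (hV : 8 ≤ Fintype.card V) (u v w₁ w₂ x y : V)
    (hvw : G.Adj v w₁) (hvx : G.Adj v x)
    (hww : G.Adj w₁ w₂) (hwy : G.Adj w₁ y) (hnd : [u, v, w₁, w₂, x, y].Nodup)
    (hu : ∀ z, z ≠ u → z ≠ w₁ → z ≠ w₂ → G.Adj u z) :
    ∃ T : SimpleGraph V, G.IsHIST T := by
  classical
  obtain ⟨a, b, c, hab, hac, hbc, ha, hb, hc⟩ :=
    exists_three_notMem ({u, w₁, w₂, x, y} : Finset V) (by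
      have := Finset.card_le_five (a := u) (b := w₁) (c := w₂) (d := x) (e := y)
      omega)
  simp only [Finset.mem_insert, Finset.mem_singleton, not_or] at ha hb hc
  simp only [List.nodup_cons, List.mem_cons, List.not_mem_nil, or_false, not_or] at hnd
  refine G.exists_isHIST_of_parent u
    (fun z => if z = w₁ ∨ z = x then v else if z = w₂ ∨ z = y then w₁ else u) ?_ ?_ ?_ ?_ ?_
  · grind
  · grind
  · intro z hz
    split_ifs with h h'
    · rcases h with rfl | rfl
      · exact hvw.symm
      · exact hvx.symm
    · rcases h' with rfl | rfl
      · exact hww.symm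
      · exact hwy.symm
    · rw [not_or] at h h'
      exact (hu z hz h.1 h'.1).symm
  · exact ⟨a, b, c, hab, hac, hbc, by grind, by grind, by grind⟩
  · intro z hz
    by_cases h1 : z = w₁
    · exact ⟨x, by grind⟩
    · by_cases h2 : z = x
      · exact ⟨w₁, by grind⟩
      · by_cases h3 : z = w₂
        · exact ⟨y, by grind⟩
        · exact ⟨w₂, by grind⟩

/-! ### Degree consequences of the spectral bound -/

open Classical in
theorem exists_sum_degree_neighbors_ge {V : Type*} [Fintype V] (G : SimpleGraph V) (s : ℕ)
    (hs : 5 ≤ s) (hcard : Fintype.card V = s + 3)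
    (hρ : (s : ℝ) - 1 + 2 / ((s : ℝ) - 1) ≤ G.specRadius) :
    ∃ v, (s : ℤ) ^ 2 - 3 * s + 6 ≤ ∑ w ∈ G.neighborFinset v, ((G.degree w : ℤ) - 1) := by
  have : Nonempty V := Fintype.card_pos_iff.1 (by omega)
  obtain ⟨v, hv⟩ := G.exists_specRadius_sq_sub_le
  refine ⟨v, ?_⟩
  have hs' : (5 : ℝ) ≤ s := by exact_mod_cast hs
  set ρ := G.specRadius
  set t : ℝ := 2 / ((s : ℝ) - 1) with ht
  have ht0 : 0 < t := div_pos two_pos (by linarith)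
  have ht1 : t * ((s : ℝ) - 1) = 2 := div_mul_cancel₀ _ (by linarith)
  have ht2 : t < 1 := by
    rw [ht, div_lt_one (by linarith)]
    linarith
  -- At `ρ = s - 1 + t`, where `t (s - 1) = 2`, the right side equals `s² - 3s + 6 - t + t²`, and `0
  -- < t < 1`. The product in `h2` is the monotonicity of `x² - x`.
  have h1 : (s : ℝ) ^ 2 - 3 * s + 5 < ρ ^ 2 - ρ := by
    have h2 : 0 ≤ (ρ - ((s : ℝ) - 1 + t)) * (ρ + ((s : ℝ) - 1 + t) - 1) :=
      mul_nonneg (by linarith) (by linarith)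
    nlinarith [mul_pos ht0 ht0]
  have h3 : (((s : ℤ) ^ 2 - 3 * s + 5 : ℤ) : ℝ) <
      ((∑ w ∈ G.neighborFinset v, ((G.degree w : ℤ) - 1) : ℤ) : ℝ) := by
    push_cast
    exact h1.trans_le hv
  have h4 := Int.cast_lt.1 h3
  linarith [Int.add_one_le_iff.2 h4]

-- If all degrees were at most `s - 1`, the sum would be at most `(s - 1)(s - 2) = s² - 3s + 2`.
open Classical in
theorem exists_le_degree_of_sum {V : Type*} [Fintype V] (G : SimpleGraph V) (s : ℕ) (hs : 5 ≤ s)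
    (v : V) (hv : (s : ℤ) ^ 2 - 3 * s + 6 ≤ ∑ w ∈ G.neighborFinset v, ((G.degree w : ℤ) - 1)) :
    ∃ u, s ≤ G.degree u := by
  by_contra! h
  have h1 : ∑ w ∈ G.neighborFinset v, ((G.degree w : ℤ) - 1) ≤
      (G.neighborFinset v).card • ((s : ℤ) - 2) := by
    refine Finset.sum_le_card_nsmul _ _ _ fun w _ => ?_
    have := h w
    omega
  rw [G.card_neighborFinset_eq_degree, nsmul_eq_mul] at h1
  have h2 : (G.degree v : ℤ) ≤ s - 1 := by
    have := h v
    omega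
  have h3 : (5 : ℤ) ≤ s := by exact_mod_cast hs
  nlinarith

-- The neighbours of `v` contribute the given sum plus `deg v`, `v` itself adds `deg v`, and the
-- other `s + 2 - deg v` vertices have degree at least 2, so `deg v` cancels.
open Classical in
theorem le_sum_degree_of_sum {V : Type*} [Fintype V] (G : SimpleGraph V) (s : ℕ)
    (hcard : Fintype.card V = s + 3) (hmin : ∀ v, 2 ≤ G.degree v)
    (v : V) (hv : (s : ℤ) ^ 2 - 3 * s + 6 ≤ ∑ w ∈ G.neighborFinset v, ((G.degree w : ℤ) - 1)) :
    (s : ℤ) ^ 2 - s + 10 ≤ ∑ w, (G.degree w : ℤ) := by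
  set R := (insert v (G.neighborFinset v))ᶜ with hR
  have hvn : v ∉ G.neighborFinset v := by simp
  have hRc : (R.card : ℤ) = s + 2 - G.degree v := by
    have h1 := Finset.card_add_card_compl (insert v (G.neighborFinset v))
    rw [Finset.card_insert_of_notMem hvn, G.card_neighborFinset_eq_degree, hcard] at h1
    rw [hR]
    omega
  have hsplit : ∑ w, (G.degree w : ℤ) =
      G.degree v + ∑ w ∈ G.neighborFinset v, (G.degree w : ℤ) + ∑ w ∈ R, (G.degree w : ℤ) := by
    rw [← Finset.sum_insert (f := fun w => (G.degree w : ℤ)) hvn, hR, Finset.sum_add_sum_compl]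
  have hRs : R.card • (2 : ℤ) ≤ ∑ w ∈ R, (G.degree w : ℤ) :=
    Finset.card_nsmul_le_sum _ _ _ fun w _ => by exact_mod_cast hmin w
  rw [Finset.sum_sub_distrib] at hv
  simp only [Finset.sum_const, G.card_neighborFinset_eq_degree, nsmul_eq_mul, mul_one] at hv hRs
  rw [hsplit]
  linarith

/-! ### One non-neighbour -/

open Classical in
theorem degree_add_card_le {V : Type*} [Fintype V] (G : SimpleGraph V) (z : V) (F : Finset V)
    (hF : ∀ y ∈ F, ¬ G.Adj z y) : G.degree z + F.card ≤ Fintype.card V := by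
  rw [← G.card_neighborFinset_eq_degree, ← Finset.card_union_of_disjoint]
  · exact Finset.card_le_univ _
  · rw [Finset.disjoint_left]
    intro y hy hyF
    exact hF y hyF ((G.mem_neighborFinset z y).1 hy)

open Classical in
/-- If `u` is adjacent to all vertices but `w`, then a graph with sufficiently many edges has a
HIST. -/
theorem exists_isHIST_of_one_missing {V : Type*} [Fintype V] (G : SimpleGraph V) (s : ℕ)
    (hs : 5 ≤ s) (hcard : Fintype.card V = s + 3) (hmin : ∀ v, 2 ≤ G.degree v)
    (hsum : (s : ℤ) ^ 2 - s + 10 ≤ ∑ w, (G.degree w : ℤ)) (u w : V) (hwu : w ≠ u)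
    (huw : ¬ G.Adj u w) (hu : ∀ z, z ≠ u → z ≠ w → G.Adj u z) :
    ∃ T : SimpleGraph V, G.IsHIST T := by
  set A := G.neighborFinset w with hA
  have hAu : ∀ v ∈ A, G.Adj u v := by
    intro v hv
    rw [hA, mem_neighborFinset] at hv
    exact hu v (fun h => huw (h ▸ hv.symm)) hv.ne'
  by_cases h3 : ∃ v ∈ A, 3 ≤ G.degree v
  · obtain ⟨v, hv, h3⟩ := h3
    have hlt : ({u, w} : Finset V).card < (G.neighborFinset v).card := by
      rw [G.card_neighborFinset_eq_degree]
      exact lt_of_le_of_lt Finset.card_le_two h3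
    obtain ⟨x, hx, hxn⟩ := Finset.exists_mem_notMem_of_card_lt_card hlt
    simp only [Finset.mem_insert, Finset.mem_singleton, not_or] at hxn
    exact G.exists_isHIST_of_double_star (by omega) u v w x (hAu v hv)
      ((G.mem_neighborFinset w v).1 hv).symm ((G.mem_neighborFinset v x).1 hx) (Ne.symm hxn.2) hwu
      hxn.1 (fun z h1 h2 _ => hu z h1 h2)
  -- Now each neighbour of `w` is adjacent to `u` and `w` only, so the remaining `s + 1 - d`
  -- vertices see only `u` and one another.
  · push Not at h3
    exfalso
    set d := G.degree w with hd
    have hAc : A.card = d := G.card_neighborFinset_eq_degree w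
    have hwA : w ∉ A := by simp [hA]
    have huA : u ∉ insert w A := by
      rw [Finset.mem_insert, not_or, hA, mem_neighborFinset]
      exact ⟨hwu.symm, fun h => huw h.symm⟩
    set R := (insert u (insert w A))ᶜ with hR
    have hRc : (R.card : ℤ) = s + 1 - d := by
      have h1 : (insert u (insert w A)).card + R.card = Fintype.card V :=
        Finset.card_add_card_compl _
      rw [Finset.card_insert_of_notMem huA, Finset.card_insert_of_notMem hwA, hAc, hcard] at h1
      omega
    have hsplit : ∑ z, (G.degree z : ℤ) =
        G.degree u + (G.degree w + ∑ z ∈ A, (G.degree z : ℤ)) + ∑ z ∈ R, (G.degree z : ℤ) := by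
      rw [← Finset.sum_insert (f := fun z => (G.degree z : ℤ)) hwA,
        ← Finset.sum_insert (f := fun z => (G.degree z : ℤ)) huA, hR, Finset.sum_add_sum_compl]
    have hAs : ∑ z ∈ A, (G.degree z : ℤ) ≤ A.card • (2 : ℤ) :=
      Finset.sum_le_card_nsmul _ _ _ fun z hz => by
        have := h3 z hz
        omega
    have hRs : ∑ z ∈ R, (G.degree z : ℤ) ≤ R.card • ((s : ℤ) + 1 - d) := by
      refine Finset.sum_le_card_nsmul _ _ _ fun z hz => ?_
      rw [hR, Finset.mem_compl, Finset.mem_insert, Finset.mem_insert, not_or, not_or] at hz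
      have hzw : z ∉ insert w A := by
        rw [Finset.mem_insert, not_or]
        exact hz.2
      have h4 := G.degree_add_card_le z (insert z (insert w A)) (by
        intro y hy
        rw [Finset.mem_insert, Finset.mem_insert] at hy
        rcases hy with rfl | rfl | hy
        · exact G.loopless.irrefl _
        · intro h
          exact hz.2.2 (by rw [hA, mem_neighborFinset]; exact h.symm)
        · intro h
          have h5 := h3 y hy
          have h6 : ({u, w, z} : Finset V) ⊆ G.neighborFinset y := by
            intro t ht
            simp only [Finset.mem_insert, Finset.mem_singleton] at ht
            rw [mem_neighborFinset]
            rcases ht with rfl | rfl | rfl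
            · exact (hAu y hy).symm
            · exact ((G.mem_neighborFinset _ _).1 hy).symm
            · exact h.symm
          have h7 := Finset.card_le_card h6
          rw [G.card_neighborFinset_eq_degree, Finset.card_eq_three.2
            ⟨u, w, z, hwu.symm, Ne.symm hz.1, Ne.symm hz.2.1, rfl⟩] at h7
          omega)
      rw [Finset.card_insert_of_notMem hzw, Finset.card_insert_of_notMem hwA, hAc, hcard] at h4
      omega
    have hdu : G.degree u ≤ s + 1 := by
      have h4 := G.degree_add_card_le u {u, w} (by simp [huw])
      rw [Finset.card_pair hwu.symm] at h4
      omega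
    have hd2 : 2 ≤ d := hmin w
    have hds : (d : ℤ) ≤ s + 1 := by
      have : (0 : ℤ) ≤ R.card := by positivity
      linarith
    rw [nsmul_eq_mul] at hAs hRs
    rw [hRc] at hRs
    rw [hAc] at hAs
    have hdu' : (G.degree u : ℤ) ≤ s + 1 := by exact_mod_cast hdu
    have hd2' : (2 : ℤ) ≤ d := by exact_mod_cast hd2
    have hs' : (5 : ℤ) ≤ s := by exact_mod_cast hs
    -- The bound `(s + 1) + 3d + (s + 1 - d)²` is convex in `d`, so only `d = 2`, with value `s² - s
    -- + 8`, and `d = s + 1` matter.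
    nlinarith [mul_nonneg (sub_nonneg.2 hd2') (sub_nonneg.2 hds)]

/-! ### Two non-neighbours: structure and counting -/

open Classical in
/-- The common neighbours of two vertices, as a finset. -/
noncomputable def commonNbrs {V : Type*} [Fintype V] (G : SimpleGraph V) (u v : V) : Finset V :=
  Finset.univ.filter fun x => G.Adj u x ∧ G.Adj v x

theorem mem_commonNbrs {V : Type*} [Fintype V] {G : SimpleGraph V} {u v x : V} :
    x ∈ G.commonNbrs u v ↔ G.Adj u x ∧ G.Adj v x := by
  simp [commonNbrs]

/-- Exactly `w₁` and `w₂` are not adjacent to `u`, they have no common neighbour adjacent to `u`,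
and there is no spanning tree formed by two brooms below the root `u`. -/
structure TwoMissing {V : Type*} [Fintype V] (G : SimpleGraph V) (u w₁ w₂ : V) : Prop where
  ne : w₁ ≠ w₂
  ne₁ : w₁ ≠ u
  ne₂ : w₂ ≠ u
  not_adj₁ : ¬ G.Adj u w₁
  not_adj₂ : ¬ G.Adj u w₂
  adj : ∀ z, z ≠ u → z ≠ w₁ → z ≠ w₂ → G.Adj u z
  disj : ∀ v ∈ G.commonNbrs u w₁, v ∉ G.commonNbrs u w₂
  broom : ∀ v₁ ∈ G.commonNbrs u w₁, ∀ v₂ ∈ G.commonNbrs u w₂, ∀ x₁ ∈ G.commonNbrs u v₁,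
    ∀ x₂ ∈ G.commonNbrs u v₂, x₁ ≠ v₂ → x₂ ≠ v₁ → x₁ = x₂

namespace TwoMissing

variable {V : Type*} [Fintype V] {G : SimpleGraph V} {u w₁ w₂ : V}

theorem symm (h : G.TwoMissing u w₁ w₂) : G.TwoMissing u w₂ w₁ where
  ne := h.ne.symm
  ne₁ := h.ne₂
  ne₂ := h.ne₁
  not_adj₁ := h.not_adj₂
  not_adj₂ := h.not_adj₁
  adj z h1 h2 h3 := h.adj z h1 h3 h2
  disj v h2 h1 := h.disj v h1 h2
  broom v₁ h1 v₂ h2 x₁ hx₁ x₂ hx₂ h3 h4 := (h.broom v₂ h2 v₁ h1 x₂ hx₂ x₁ hx₁ h4 h3).symm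

open Classical in
theorem sum_eq (h : G.TwoMissing u w₁ w₂) (f : V → ℕ) :
    ∑ x, f x = f u + f w₁ + f w₂ + ∑ x ∈ G.neighborFinset u, f x := by
  have hne := h.ne
  have hne₁ := h.ne₁
  have hne₂ := h.ne₂
  have huniv : Finset.univ = insert u (insert w₁ (insert w₂ (G.neighborFinset u))) := by
    ext z
    have := h.adj z
    simp only [Finset.mem_univ, Finset.mem_insert, mem_neighborFinset, true_iff]
    tauto
  rw [huniv, Finset.sum_insert, Finset.sum_insert, Finset.sum_insert]
  · ring
  · simpa using h.not_adj₂
  · simp [hne, h.not_adj₁]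
  · simp [hne₁.symm, hne₂.symm]

open Classical in
theorem degree_eq (h : G.TwoMissing u w₁ w₂) (z : V) :
    G.degree z = (if G.Adj z u then 1 else 0) + (if G.Adj z w₁ then 1 else 0) +
      (if G.Adj z w₂ then 1 else 0) + (G.commonNbrs u z).card := by
  rw [← G.card_neighborFinset_eq_degree, G.neighborFinset_eq_filter, Finset.card_filter,
    h.sum_eq, ← Finset.card_filter]
  congr 2
  ext x
  simp [mem_commonNbrs]

-- Reduces every later count to bounding the last sum, which is twice the number of edges inside
-- `N(u)`.
open Classical in
theorem sum_degree_eq (h : G.TwoMissing u w₁ w₂) :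
    ∑ z, G.degree z = 2 * G.degree u + 2 * (G.commonNbrs u w₁).card + 2 * (G.commonNbrs u w₂).card
      + 2 * (if G.Adj w₁ w₂ then 1 else 0)
      + ∑ z ∈ G.neighborFinset u, (G.commonNbrs u z).card := by
  have hc : ∀ w, ∑ z ∈ G.neighborFinset u, (if G.Adj z w then 1 else 0) =
      (G.commonNbrs u w).card := by
    intro w
    rw [← Finset.card_filter]
    congr 1
    ext x
    simp [mem_commonNbrs, G.adj_comm w x]
  have huu : ∑ z ∈ G.neighborFinset u, (if G.Adj z u then 1 else 0) = G.degree u := by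
    rw [hc, ← G.card_neighborFinset_eq_degree]
    congr 1
    ext x
    simp [mem_commonNbrs]
  rw [h.sum_eq]
  have h1 : ∑ z ∈ G.neighborFinset u, G.degree z = G.degree u + (G.commonNbrs u w₁).card +
      (G.commonNbrs u w₂).card + ∑ z ∈ G.neighborFinset u, (G.commonNbrs u z).card := by
    rw [Finset.sum_congr rfl fun z _ => h.degree_eq z, Finset.sum_add_distrib,
      Finset.sum_add_distrib, Finset.sum_add_distrib, huu, hc, hc]
  rw [h1, h.degree_eq w₁, h.degree_eq w₂]
  simp only [G.adj_comm w₁ u, G.adj_comm w₂ u, h.not_adj₁, h.not_adj₂, G.adj_comm w₂ w₁,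
    G.irrefl, if_false]
  ring

open Classical in
theorem card_add_card_le (h : G.TwoMissing u w₁ w₂) :
    (G.commonNbrs u w₁).card + (G.commonNbrs u w₂).card ≤ G.degree u := by
  rw [← Finset.card_union_of_disjoint (Finset.disjoint_left.2 h.disj),
    ← G.card_neighborFinset_eq_degree]
  refine Finset.card_le_card fun x hx => ?_
  rw [mem_neighborFinset]
  rcases Finset.mem_union.1 hx with hx | hx <;> exact (mem_commonNbrs.1 hx).1

end TwoMissing

open Classical in
theorem card_commonNbrs_add_card_le {V : Type*} [Fintype V] (G : SimpleGraph V) (u z : V)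
    (F : Finset V) (hF : F ⊆ G.neighborFinset u) (hz : ∀ y ∈ F, ¬ G.Adj z y) :
    (G.commonNbrs u z).card + F.card ≤ G.degree u := by
  rw [← Finset.card_union_of_disjoint (Finset.disjoint_left.2 fun y hy hyF =>
    hz y hyF (mem_commonNbrs.1 hy).2), ← G.card_neighborFinset_eq_degree]
  refine Finset.card_le_card (Finset.union_subset (fun x hx => ?_) hF)
  rw [mem_neighborFinset]
  exact (mem_commonNbrs.1 hx).1

/-- A bound for a sum over a set split into three parts. -/
theorem sum_le_of_three_parts {V : Type*} [DecidableEq V] (S P Q : Finset V) (f : V → ℕ)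
    (α β γ : ℤ) (hP : P ⊆ S) (hQ : Q ⊆ S) (hPQ : ∀ v ∈ P, v ∉ Q) (hα : ∀ v ∈ P, (f v : ℤ) ≤ α)
    (hβ : ∀ v ∈ Q, (f v : ℤ) ≤ β) (hγ : ∀ v ∈ S, v ∉ P → v ∉ Q → (f v : ℤ) ≤ γ) :
    ((∑ v ∈ S, f v : ℕ) : ℤ) ≤ P.card * α + Q.card * β + ((S.card : ℤ) - P.card - Q.card) * γ := by
  have hd : Disjoint P Q := Finset.disjoint_left.2 hPQ
  have hsub : P ∪ Q ⊆ S := Finset.union_subset hP hQ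
  have h1 := Finset.sum_le_card_nsmul P (fun v => (f v : ℤ)) α hα
  have h2 := Finset.sum_le_card_nsmul Q (fun v => (f v : ℤ)) β hβ
  have h3 := Finset.sum_le_card_nsmul (S \ (P ∪ Q)) (fun v => (f v : ℤ)) γ (by
    intro v hv
    rw [Finset.mem_sdiff, Finset.mem_union, not_or] at hv
    exact hγ v hv.1 hv.2.1 hv.2.2)
  have h4 : (((S \ (P ∪ Q)).card : ℕ) : ℤ) = (S.card : ℤ) - P.card - Q.card := by
    have := Finset.card_sdiff_add_card_eq_card hsub
    rw [Finset.card_union_of_disjoint hd] at this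
    omega
  have h5 : ∑ v ∈ S, (f v : ℤ) =
      ∑ v ∈ S \ (P ∪ Q), (f v : ℤ) + (∑ v ∈ P, (f v : ℤ) + ∑ v ∈ Q, (f v : ℤ)) := by
    rw [← Finset.sum_union hd, Finset.sum_sdiff hsub]
  rw [nsmul_eq_mul] at h1 h2 h3
  rw [h4] at h3
  push_cast
  rw [h5]
  linarith

namespace TwoMissing

variable {V : Type*} [Fintype V] {G : SimpleGraph V} {u w₁ w₂ : V}

open Classical in
theorem subset_neighborFinset (G : SimpleGraph V) (u w : V) :
    G.commonNbrs u w ⊆ G.neighborFinset u := fun x hx => by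
  rw [mem_neighborFinset]
  exact (mem_commonNbrs.1 hx).1

open Classical in
theorem card_commonNbrs_lt (G : SimpleGraph V) {v : V} (hv : G.Adj u v) :
    (G.commonNbrs u v).card + 1 ≤ G.degree u := by
  simpa using G.card_commonNbrs_add_card_le u v {v} (by simpa using hv) (by simp)

-- Besides these common neighbours, `v` is adjacent to `u` and `w₁`; maximality of `deg u` thus
-- saves one over `card_commonNbrs_lt`. The two tightest counts need this.
open Classical in
theorem card_commonNbrs_add_two_le (h : G.TwoMissing u w₁ w₂) {v : V}
    (hmax : G.degree v ≤ G.degree u) (hv : v ∈ G.commonNbrs u w₁) :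
    (G.commonNbrs u v).card + 2 ≤ G.degree u := by
  have := h.degree_eq v
  rw [mem_commonNbrs] at hv
  rw [if_pos hv.1.symm, if_pos hv.2.symm] at this
  omega

/-- If a neighbour of `w₂` has three common neighbours with `u`, then each neighbour `v` of `w₁` has
at most one common neighbour with `u`. -/
theorem subset_singleton_of_three_le (h : G.TwoMissing u w₁ w₂) {v v₂ : V}
    (hv : v ∈ G.commonNbrs u w₁) (hv₂ : v₂ ∈ G.commonNbrs u w₂)
    (h3 : 3 ≤ (G.commonNbrs u v₂).card) : G.commonNbrs u v ⊆ {v₂} := by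
  classical
  intro x hx
  rw [Finset.mem_singleton]
  by_contra hne
  have hlt : ({v, x} : Finset V).card < (G.commonNbrs u v₂).card :=
    lt_of_le_of_lt Finset.card_le_two h3
  obtain ⟨y, hy, hyn⟩ := Finset.exists_mem_notMem_of_card_lt_card hlt
  simp only [Finset.mem_insert, Finset.mem_singleton, not_or] at hyn
  exact hyn.2 (h.broom v hv v₂ hv₂ x hx y hy hne hyn.1).symm

/-! ### Two non-adjacent non-neighbours -/

-- Every neighbour of `w₁` in `N(u)` sees at most `v₂` there. So a vertex of `N(u)` that is neither
-- `v₂` nor a neighbour of `w₁` misses itself and all those neighbours, which leaves too few edges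
-- inside `N(u)`.
open Classical in
theorem false_of_three_le (h : G.TwoMissing u w₁ w₂) (hmax : ∀ v, G.degree v ≤ G.degree u)
    (hw : ¬ G.Adj w₁ w₂) (ha : 2 ≤ (G.commonNbrs u w₁).card)
    (hsum : (G.degree u : ℤ) ^ 2 - G.degree u + 10 ≤ ((∑ w, G.degree w : ℕ) : ℤ))
    {v₂ : V} (hv₂ : v₂ ∈ G.commonNbrs u w₂) (h3 : 3 ≤ (G.commonNbrs u v₂).card) : False := by
  have hA : ∀ v ∈ G.commonNbrs u w₁, G.commonNbrs u v ⊆ {v₂} := fun v hv =>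
    h.subset_singleton_of_three_le hv hv₂ h3
  have hb : 1 ≤ (G.commonNbrs u w₂).card := Finset.card_pos.2 ⟨v₂, hv₂⟩
  have hab := h.card_add_card_le
  have hbd := sum_le_of_three_parts (G.neighborFinset u) (G.commonNbrs u w₁) {v₂}
    (fun v => (G.commonNbrs u v).card) 1 (G.degree u - 2)
    (G.degree u - 1 - (G.commonNbrs u w₁).card) (subset_neighborFinset G u w₁)
    (by simpa using (mem_commonNbrs.1 hv₂).1)
    (by
      intro v hv hv'
      rw [Finset.mem_singleton] at hv'
      exact h.disj v hv (hv' ▸ hv₂))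
    (by
      intro v hv
      have := Finset.card_le_card (hA v hv)
      rw [Finset.card_singleton] at this
      exact_mod_cast this)
    (by
      intro v hv
      rw [Finset.mem_singleton] at hv
      subst hv
      have := h.symm.card_commonNbrs_add_two_le (hmax v) hv₂
      omega)
    (by
      intro v hv hv1 hv2
      have hvu := (G.mem_neighborFinset u v).1 hv
      have := G.card_commonNbrs_add_card_le u v (insert v (G.commonNbrs u w₁))
        (Finset.insert_subset hv (subset_neighborFinset G u w₁)) (by
          intro y hy hvy
          rcases Finset.mem_insert.1 hy with rfl | hy
          · exact G.irrefl hvy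
          · exact hv2 (hA y hy (mem_commonNbrs.2 ⟨hvu, hvy.symm⟩)))
      rw [Finset.card_insert_of_notMem hv1] at this
      omega)
  rw [h.sum_degree_eq, if_neg hw] at hsum
  rw [Finset.card_singleton, G.card_neighborFinset_eq_degree] at hbd
  push_cast at hsum hbd
  zify at ha hb hab
  generalize ((G.commonNbrs u w₁).card : ℤ) = a at *
  generalize ((G.commonNbrs u w₂).card : ℤ) = b at *
  generalize (G.degree u : ℤ) = s at *
  -- With `b ≤ s - a`, the threshold exceeds the count by at least `2(a - 2)(s - 1 - a) + ((2a - 5)²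
  -- + 3)/4`, which is positive.
  nlinarith [mul_nonneg (sub_nonneg.2 ha) (show 0 ≤ s - a - 1 by linarith),
    sq_nonneg (2 * a - 5)]

open Classical in
/-- The case of nonadjacent `w₁` and `w₂`. -/
theorem false_of_not_adj (h : G.TwoMissing u w₁ w₂) (hs : 5 ≤ G.degree u)
    (hmax : ∀ v, G.degree v ≤ G.degree u)
    (hw : ¬ G.Adj w₁ w₂) (hmin₁ : 2 ≤ G.degree w₁) (hmin₂ : 2 ≤ G.degree w₂)
    (hsum : (G.degree u : ℤ) ^ 2 - G.degree u + 10 ≤ ((∑ w, G.degree w : ℕ) : ℤ)) : False := by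
  have hw' : ¬ G.Adj w₂ w₁ := fun h => hw h.symm
  have ha : 2 ≤ (G.commonNbrs u w₁).card := by
    simpa [h.degree_eq w₁, G.adj_comm w₁ u, h.not_adj₁, hw] using hmin₁
  have hb : 2 ≤ (G.commonNbrs u w₂).card := by
    simpa [h.degree_eq w₂, G.adj_comm w₂ u, h.not_adj₂, hw'] using hmin₂
  have h2₁ : ∀ v ∈ G.commonNbrs u w₁, (G.commonNbrs u v).card ≤ 2 := by
    intro v hv
    by_contra! h3
    exact h.symm.false_of_three_le hmax hw' hb hsum hv h3
  have h2₂ : ∀ v ∈ G.commonNbrs u w₂, (G.commonNbrs u v).card ≤ 2 := by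
    intro v hv
    by_contra! h3
    exact h.false_of_three_le hmax hw ha hsum hv h3
  set C := G.commonNbrs u w₁ ∪ G.commonNbrs u w₂ with hC
  have hCc : C.card = (G.commonNbrs u w₁).card + (G.commonNbrs u w₂).card :=
    Finset.card_union_of_disjoint (Finset.disjoint_left.2 h.disj)
  have hCS : C ⊆ G.neighborFinset u :=
    Finset.union_subset (subset_neighborFinset G u w₁) (subset_neighborFinset G u w₂)
  -- The bound 2 on all of `C` is not enough when `s = 5` and `a + b = 4`, so one vertex must do
  -- better. Otherwise two brooms exist: a non-adjacent pair `v₁`, `v₂` has distinct companions, and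
  -- if all pairs are adjacent, the companions are chosen crosswise.
  obtain ⟨v₀, hv₀, hv₀'⟩ : ∃ v₀ ∈ C, (G.commonNbrs u v₀).card ≤ 1 := by
    by_contra! hge
    by_cases hnon : ∃ v₁ ∈ G.commonNbrs u w₁, ∃ v₂ ∈ G.commonNbrs u w₂, ¬ G.Adj v₁ v₂
    · obtain ⟨v₁, hv₁, v₂, hv₂, hn⟩ := hnon
      obtain ⟨x₁, hx₁⟩ := Finset.card_pos.1
        (zero_lt_one.trans (hge v₁ (Finset.mem_union_left _ hv₁)))
      obtain ⟨x₂, hx₂, hne⟩ := Finset.exists_mem_ne (hge v₂ (Finset.mem_union_right _ hv₂)) x₁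
      refine hne (h.broom v₁ hv₁ v₂ hv₂ x₁ hx₁ x₂ hx₂ ?_ ?_).symm
      · rintro rfl
        exact hn (mem_commonNbrs.1 hx₁).2
      · rintro rfl
        exact hn (mem_commonNbrs.1 hx₂).2.symm
    · push Not at hnon
      obtain ⟨v₁, hv₁⟩ := Finset.card_pos.1 (zero_lt_two.trans_le ha)
      obtain ⟨v₂, hv₂⟩ := Finset.card_pos.1 (zero_lt_two.trans_le hb)
      obtain ⟨x₁, hx₁, hne₁⟩ := Finset.exists_mem_ne hb v₂
      obtain ⟨x₂, hx₂, hne₂⟩ := Finset.exists_mem_ne ha v₁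
      have := h.broom v₁ hv₁ v₂ hv₂ x₁ (mem_commonNbrs.2 ⟨(mem_commonNbrs.1 hx₁).1,
        hnon v₁ hv₁ x₁ hx₁⟩) x₂ (mem_commonNbrs.2 ⟨(mem_commonNbrs.1 hx₂).1,
        (hnon x₂ hx₂ v₂ hv₂).symm⟩) hne₁ hne₂
      exact h.disj x₂ hx₂ (this ▸ hx₁)
  have hbd := sum_le_of_three_parts (G.neighborFinset u) {v₀} (C.erase v₀)
    (fun v => (G.commonNbrs u v).card) 1 2 (G.degree u - 1)
    (by simpa using (hCS hv₀)) ((Finset.erase_subset _ _).trans hCS) (by simp)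
    (by
      intro v hv
      rw [Finset.mem_singleton] at hv
      subst hv
      exact_mod_cast hv₀')
    (by
      intro v hv
      rcases Finset.mem_union.1 (Finset.mem_of_mem_erase hv) with hv | hv
      · exact_mod_cast h2₁ v hv
      · exact_mod_cast h2₂ v hv)
    (by
      intro v hv _ _
      have := card_commonNbrs_lt G ((G.mem_neighborFinset u v).1 hv)
      omega)
  have herase : ((C.erase v₀).card : ℤ) =
      (G.commonNbrs u w₁).card + (G.commonNbrs u w₂).card - 1 := by
    have := Finset.card_erase_add_one hv₀
    omega
  rw [h.sum_degree_eq, if_neg hw] at hsum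
  rw [Finset.card_singleton, G.card_neighborFinset_eq_degree, herase] at hbd
  push_cast at hsum hbd
  zify at ha hb hs
  generalize ((G.commonNbrs u w₁).card : ℤ) = a at *
  generalize ((G.commonNbrs u w₂).card : ℤ) = b at *
  generalize (G.degree u : ℤ) = s at *
  nlinarith [mul_nonneg (show 0 ≤ a + b - 4 by linarith) (sub_nonneg.2 hs)]

/-! ### Two adjacent non-neighbours -/

-- With three neighbours of `w₁` in `N(u)`, some `y` avoids both `v` and any candidate `x`, which
-- `hdeep` forbids. So these neighbours have no neighbour inside `N(u)` at all.
open Classical in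
theorem card_le_two_of_adj (h : G.TwoMissing u w₁ w₂) (hb : 1 ≤ (G.commonNbrs u w₂).card)
    (hw : G.Adj w₁ w₂)
    (hdeep : ∀ v ∈ G.commonNbrs u w₁, ∀ x ∈ G.commonNbrs u v, ∀ y ∈ G.commonNbrs u w₁,
      y ≠ v → y = x)
    (hsum : (G.degree u : ℤ) ^ 2 - G.degree u + 10 ≤ ((∑ w, G.degree w : ℕ) : ℤ)) :
    (G.commonNbrs u w₁).card ≤ 2 := by
  by_contra! ha
  have hD : ∀ v ∈ G.commonNbrs u w₁, ∀ x, x ∉ G.commonNbrs u v := by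
    intro v hv x hx
    have hlt : ({v, x} : Finset V).card < (G.commonNbrs u w₁).card :=
      lt_of_le_of_lt Finset.card_le_two ha
    obtain ⟨y, hy, hyn⟩ := Finset.exists_mem_notMem_of_card_lt_card hlt
    simp only [Finset.mem_insert, Finset.mem_singleton, not_or] at hyn
    exact hyn.2 (hdeep v hv x hx y hy hyn.1)
  have hab := h.card_add_card_le
  have hbd := sum_le_of_three_parts (G.neighborFinset u) (G.commonNbrs u w₁) ∅
    (fun v => (G.commonNbrs u v).card) 0 0
    (G.degree u - 1 - (G.commonNbrs u w₁).card) (subset_neighborFinset G u w₁)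
    (by simp) (by simp)
    (by
      intro v hv
      rw [Finset.eq_empty_of_forall_notMem (hD v hv)]
      simp)
    (by simp)
    (by
      intro v hv hv1 _
      have hvu := (G.mem_neighborFinset u v).1 hv
      have := G.card_commonNbrs_add_card_le u v (insert v (G.commonNbrs u w₁))
        (Finset.insert_subset hv (subset_neighborFinset G u w₁)) (by
          intro y hy hvy
          rcases Finset.mem_insert.1 hy with rfl | hy
          · exact G.irrefl hvy
          · exact hD y hy v (mem_commonNbrs.2 ⟨hvu, hvy.symm⟩))
      rw [Finset.card_insert_of_notMem hv1] at this
      omega)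
  rw [h.sum_degree_eq, if_pos hw] at hsum
  rw [Finset.card_empty, G.card_neighborFinset_eq_degree] at hbd
  push_cast at hsum hbd
  zify at ha hb hab
  generalize ((G.commonNbrs u w₁).card : ℤ) = a at *
  generalize ((G.commonNbrs u w₂).card : ℤ) = b at *
  generalize (G.degree u : ℤ) = s at *
  nlinarith [mul_nonneg (show 0 ≤ a - 3 by linarith) (show 0 ≤ s - 1 - a by linarith)]

-- If there are two such neighbours of `w₁`, each can see only the other inside `N(u)`, and both are
-- cut off from the rest of `N(u)`.
open Classical in
theorem card_eq_one_of_adj (h : G.TwoMissing u w₁ w₂) (hs : 5 ≤ G.degree u)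
    (ha : 1 ≤ (G.commonNbrs u w₁).card) (ha2 : (G.commonNbrs u w₁).card ≤ 2)
    (hb2 : (G.commonNbrs u w₂).card ≤ 2)
    (hw : G.Adj w₁ w₂)
    (hdeep : ∀ v ∈ G.commonNbrs u w₁, ∀ x ∈ G.commonNbrs u v, ∀ y ∈ G.commonNbrs u w₁,
      y ≠ v → y = x)
    (hsum : (G.degree u : ℤ) ^ 2 - G.degree u + 10 ≤ ((∑ w, G.degree w : ℕ) : ℤ)) :
    (G.commonNbrs u w₁).card = 1 := by
  by_contra! hne
  have ha' : (G.commonNbrs u w₁).card = 2 := by omega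
  have hD : ∀ v ∈ G.commonNbrs u w₁, ∃ y ∈ G.commonNbrs u w₁, G.commonNbrs u v ⊆ {y} := by
    intro v hv
    obtain ⟨y, hy, hyn⟩ := Finset.exists_mem_ne (by omega : 1 < (G.commonNbrs u w₁).card) v
    refine ⟨y, hy, fun x hx => ?_⟩
    rw [Finset.mem_singleton, hdeep v hv x hx y hy hyn]
  have hbd := sum_le_of_three_parts (G.neighborFinset u) (G.commonNbrs u w₁) ∅
    (fun v => (G.commonNbrs u v).card) 1 0
    (G.degree u - 3) (subset_neighborFinset G u w₁)
    (by simp) (by simp)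
    (by
      intro v hv
      obtain ⟨y, -, hy⟩ := hD v hv
      have := Finset.card_le_card hy
      rw [Finset.card_singleton] at this
      exact_mod_cast this)
    (by simp)
    (by
      intro v hv hv1 _
      have hvu := (G.mem_neighborFinset u v).1 hv
      have := G.card_commonNbrs_add_card_le u v (insert v (G.commonNbrs u w₁))
        (Finset.insert_subset hv (subset_neighborFinset G u w₁)) (by
          intro y hy hvy
          rcases Finset.mem_insert.1 hy with rfl | hy
          · exact G.irrefl hvy
          · obtain ⟨z, hz, hz'⟩ := hD y hy
            have := Finset.mem_singleton.1 (hz' (mem_commonNbrs.2 ⟨hvu, hvy.symm⟩))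
            exact hv1 (this ▸ hz))
      rw [Finset.card_insert_of_notMem hv1] at this
      omega)
  rw [h.sum_degree_eq, if_pos hw, ha'] at hsum
  rw [Finset.card_empty, G.card_neighborFinset_eq_degree, ha'] at hbd
  push_cast at hsum hbd
  zify at hb2 hs
  generalize ((G.commonNbrs u w₂).card : ℤ) = b at *
  generalize (G.degree u : ℤ) = s at *
  nlinarith

-- Every vertex of `N(u)` other than `v₁` has at most `s - 2` neighbours there, where `s = deg u`:
-- `v₂` by maximality of `deg u`, the others because they miss `v₁`. The degree sum is then at most
-- `s² - s + 9`.
open Classical in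
theorem false_of_subset_singleton (h : G.TwoMissing u w₁ w₂)
    (hmax : ∀ v, G.degree v ≤ G.degree u)
    (ha : (G.commonNbrs u w₁).card = 1) (hb : (G.commonNbrs u w₂).card = 1) (hw : G.Adj w₁ w₂)
    (hsum : (G.degree u : ℤ) ^ 2 - G.degree u + 10 ≤ ((∑ w, G.degree w : ℕ) : ℤ))
    {v₁ v₂ : V} (hv₁ : v₁ ∈ G.commonNbrs u w₁) (hv₂ : v₂ ∈ G.commonNbrs u w₂)
    (hsub : G.commonNbrs u v₁ ⊆ {v₂}) : False := by
  have hv₁u := (mem_commonNbrs.1 hv₁).1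
  have hbd := sum_le_of_three_parts (G.neighborFinset u) {v₁} ∅
    (fun v => (G.commonNbrs u v).card) 1 0
    (G.degree u - 2) (by simpa using hv₁u)
    (by simp) (by simp)
    (by
      intro v hv
      rw [Finset.mem_singleton] at hv
      subst hv
      have := Finset.card_le_card hsub
      rw [Finset.card_singleton] at this
      exact_mod_cast this)
    (by simp)
    (by
      intro v hv hv1 _
      have hvu := (G.mem_neighborFinset u v).1 hv
      rw [Finset.mem_singleton] at hv1
      by_cases hv2 : v = v₂
      · subst hv2
        have := h.symm.card_commonNbrs_add_two_le (hmax v) hv₂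
        omega
      · have := G.card_commonNbrs_add_card_le u v {v, v₁}
          (Finset.insert_subset hv (by simpa using hv₁u)) (by
            intro y hy hvy
            rw [Finset.mem_insert, Finset.mem_singleton] at hy
            rcases hy with rfl | rfl
            · exact G.irrefl hvy
            · exact hv2 (Finset.mem_singleton.1 (hsub (mem_commonNbrs.2 ⟨hvu, hvy.symm⟩))))
        rw [Finset.card_pair hv1] at this
        omega)
  rw [h.sum_degree_eq, if_pos hw, ha, hb] at hsum
  rw [Finset.card_singleton, Finset.card_empty, G.card_neighborFinset_eq_degree] at hbd
  push_cast at hsum hbd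
  generalize (G.degree u : ℤ) = s at *
  nlinarith

open Classical in
theorem false_of_card_eq_one (h : G.TwoMissing u w₁ w₂) (hs : 5 ≤ G.degree u)
    (hmax : ∀ v, G.degree v ≤ G.degree u)
    (ha : (G.commonNbrs u w₁).card = 1) (hb : (G.commonNbrs u w₂).card = 1) (hw : G.Adj w₁ w₂)
    (hsum : (G.degree u : ℤ) ^ 2 - G.degree u + 10 ≤ ((∑ w, G.degree w : ℕ) : ℤ)) : False := by
  obtain ⟨v₁, hv₁⟩ := Finset.card_pos.1 (by omega : 0 < (G.commonNbrs u w₁).card)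
  obtain ⟨v₂, hv₂⟩ := Finset.card_pos.1 (by omega : 0 < (G.commonNbrs u w₂).card)
  have hne : v₁ ≠ v₂ := fun he => h.disj v₁ hv₁ (he ▸ hv₂)
  have hv₁u := (mem_commonNbrs.1 hv₁).1
  have hv₂u := (mem_commonNbrs.1 hv₂).1
  obtain ⟨x, hx, hx2⟩ : ∃ x ∈ G.commonNbrs u v₁, x ≠ v₂ := by
    by_contra! hc
    exact h.false_of_subset_singleton hmax ha hb hw hsum hv₁ hv₂
      fun x hx => Finset.mem_singleton.2 (hc x hx)
  obtain ⟨x', hx', hx1⟩ : ∃ x ∈ G.commonNbrs u v₂, x ≠ v₁ := by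
    by_contra! hc
    exact h.symm.false_of_subset_singleton hmax hb ha hw.symm hsum hv₂ hv₁
      fun x hx => Finset.mem_singleton.2 (hc x hx)
  -- The absence of two brooms forces the companions of `v₁` and `v₂` to be one vertex `x`. Inside
  -- `N(u)` they then see only `x` and possibly each other, so all other vertices there miss both.
  have hxx := h.broom v₁ hv₁ v₂ hv₂ x hx x' hx' hx2 hx1
  subst hxx
  have hN₁ : G.commonNbrs u v₁ ⊆ {x, v₂} := by
    intro y hy
    rw [Finset.mem_insert, Finset.mem_singleton, or_iff_not_imp_right]
    exact fun hy2 => h.broom v₁ hv₁ v₂ hv₂ y hy x hx' hy2 hx1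
  have hN₂ : G.commonNbrs u v₂ ⊆ {x, v₁} := by
    intro y hy
    rw [Finset.mem_insert, Finset.mem_singleton, or_iff_not_imp_right]
    exact fun hy1 => (h.broom v₁ hv₁ v₂ hv₂ x hx y hy hx2 hy1).symm
  have hbd := sum_le_of_three_parts (G.neighborFinset u) {v₁, v₂} {x}
    (fun v => (G.commonNbrs u v).card) 2 (G.degree u - 1)
    (G.degree u - 3) (Finset.insert_subset (by simpa using hv₁u) (by simpa using hv₂u))
    (by simpa using (mem_commonNbrs.1 hx).1) (by simp [hx1.symm, hx2.symm])
    (by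
      intro v hv
      rw [Finset.mem_insert, Finset.mem_singleton] at hv
      rcases hv with rfl | rfl
      · exact_mod_cast (Finset.card_le_card hN₁).trans Finset.card_le_two
      · exact_mod_cast (Finset.card_le_card hN₂).trans Finset.card_le_two)
    (by
      intro v hv
      rw [Finset.mem_singleton] at hv
      subst hv
      have := card_commonNbrs_lt G (mem_commonNbrs.1 hx).1
      omega)
    (by
      intro v hv hv12 hvx
      have hvu := (G.mem_neighborFinset u v).1 hv
      rw [Finset.mem_singleton] at hvx
      rw [Finset.mem_insert, Finset.mem_singleton, not_or] at hv12
      have := G.card_commonNbrs_add_card_le u v {v, v₁, v₂}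
        (Finset.insert_subset hv (Finset.insert_subset (by simpa using hv₁u)
          (by simpa using hv₂u))) (by
          intro y hy hvy
          rw [Finset.mem_insert, Finset.mem_insert, Finset.mem_singleton] at hy
          rcases hy with rfl | rfl | rfl
          · exact G.irrefl hvy
          · have := hN₁ (mem_commonNbrs.2 ⟨hvu, hvy.symm⟩)
            rw [Finset.mem_insert, Finset.mem_singleton] at this
            tauto
          · have := hN₂ (mem_commonNbrs.2 ⟨hvu, hvy.symm⟩)
            rw [Finset.mem_insert, Finset.mem_singleton] at this
            tauto)
      rw [Finset.card_eq_three.2 ⟨v, v₁, v₂, hv12.1, hv12.2, hne, rfl⟩] at this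
      omega)
  rw [h.sum_degree_eq, if_pos hw, ha, hb] at hsum
  rw [Finset.card_singleton, Finset.card_pair hne, G.card_neighborFinset_eq_degree] at hbd
  push_cast at hsum hbd
  zify at hs
  generalize (G.degree u : ℤ) = s at *
  nlinarith

open Classical in
/-- The case of adjacent `w₁` and `w₂`. -/
theorem false_of_adj (h : G.TwoMissing u w₁ w₂) (hs : 5 ≤ G.degree u)
    (hmax : ∀ v, G.degree v ≤ G.degree u)
    (hw : G.Adj w₁ w₂) (hmin₁ : 2 ≤ G.degree w₁) (hmin₂ : 2 ≤ G.degree w₂)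
    (hdeep₁ : ∀ v ∈ G.commonNbrs u w₁, ∀ x ∈ G.commonNbrs u v, ∀ y ∈ G.commonNbrs u w₁,
      y ≠ v → y = x)
    (hdeep₂ : ∀ v ∈ G.commonNbrs u w₂, ∀ x ∈ G.commonNbrs u v, ∀ y ∈ G.commonNbrs u w₂,
      y ≠ v → y = x)
    (hsum : (G.degree u : ℤ) ^ 2 - G.degree u + 10 ≤ ((∑ w, G.degree w : ℕ) : ℤ)) : False := by
  have ha : 1 ≤ (G.commonNbrs u w₁).card := by
    have := h.degree_eq w₁
    simp only [G.adj_comm w₁ u, h.not_adj₁, hw, G.irrefl, if_true, if_false] at this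
    omega
  have hb : 1 ≤ (G.commonNbrs u w₂).card := by
    have := h.degree_eq w₂
    simp only [G.adj_comm w₂ u, h.not_adj₂, hw.symm, G.irrefl, if_true, if_false] at this
    omega
  have ha2 := h.card_le_two_of_adj hb hw hdeep₁ hsum
  have hb2 := h.symm.card_le_two_of_adj ha hw.symm hdeep₂ hsum
  exact h.false_of_card_eq_one hs hmax (h.card_eq_one_of_adj hs ha ha2 hb2 hw hdeep₁ hsum)
    (h.symm.card_eq_one_of_adj hs hb hb2 ha2 hw.symm hdeep₂ hsum) hw hsum

end TwoMissing

/-! ### From missing trees to the constraints, and the conclusion -/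

theorem eq_of_no_deep_broom {V : Type*} [Fintype V] (G : SimpleGraph V)
    (hV : 8 ≤ Fintype.card V) (hno : ¬ ∃ T : SimpleGraph V, G.IsHIST T) {u w₁ w₂ : V}
    (hne : w₁ ≠ w₂) (hne₂ : w₂ ≠ u)
    (hn₁ : ¬ G.Adj u w₁) (hn₂ : ¬ G.Adj u w₂) (hu : ∀ z, z ≠ u → z ≠ w₁ → z ≠ w₂ → G.Adj u z)
    (hw : G.Adj w₁ w₂) (v : V) (hv : v ∈ G.commonNbrs u w₁) (x : V) (hx : x ∈ G.commonNbrs u v)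
    (y : V) (hy : y ∈ G.commonNbrs u w₁) (hyv : y ≠ v) : y = x := by
  rw [mem_commonNbrs] at hv hx hy
  by_contra hyx
  refine hno (G.exists_isHIST_of_deep_broom hV u v w₁ w₂ x y hv.2.symm hx.2 hw hy.2 ?_ hu)
  have := hv.1.ne
  have := hv.2.ne
  have := hx.1.ne
  have := hx.2.ne
  have := hy.1.ne
  have := hy.2.ne
  simp only [List.nodup_cons, List.mem_cons, List.not_mem_nil, or_false, not_or]
  grind

theorem twoMissing_of_forall_not_isHIST {V : Type*} [Fintype V] (G : SimpleGraph V)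
    (hV : 8 ≤ Fintype.card V) (hno : ¬ ∃ T : SimpleGraph V, G.IsHIST T) {u w₁ w₂ : V}
    (hne : w₁ ≠ w₂) (hne₁ : w₁ ≠ u) (hne₂ : w₂ ≠ u)
    (hn₁ : ¬ G.Adj u w₁) (hn₂ : ¬ G.Adj u w₂) (hu : ∀ z, z ≠ u → z ≠ w₁ → z ≠ w₂ → G.Adj u z) :
    G.TwoMissing u w₁ w₂ := by
  have hdisj : ∀ v ∈ G.commonNbrs u w₁, v ∉ G.commonNbrs u w₂ := by
    intro v h1 h2
    rw [mem_commonNbrs] at h1 h2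
    exact hno (G.exists_isHIST_of_double_star hV u v w₁ w₂ h1.1 h1.2.symm h2.2.symm hne hne₁ hne₂
      hu)
  refine ⟨hne, hne₁, hne₂, hn₁, hn₂, hu, hdisj, ?_⟩
  intro v₁ hv₁ v₂ hv₂ x₁ hx₁ x₂ hx₂ h12 h21
  by_contra hx
  have hv : v₁ ≠ v₂ := fun he => hdisj v₁ hv₁ (he ▸ hv₂)
  rw [mem_commonNbrs] at hv₁ hv₂ hx₁ hx₂
  have := hv₁.1.ne
  have := hv₁.2.ne
  have := hx₁.1.ne
  have := hx₁.2.ne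
  have := hv₂.1.ne
  have := hv₂.2.ne
  have := hx₂.1.ne
  have := hx₂.2.ne
  refine hno (G.exists_isHIST_of_two_brooms hV u v₁ w₁ x₁ v₂ w₂ x₂ hv₁.2.symm hx₁.2 hv₂.2.symm
    hx₂.2 ?_ ?_ hx hu)
  · simp only [List.nodup_cons, List.mem_cons, List.not_mem_nil, or_false, not_or]
    grind
  · simp only [List.nodup_cons, List.mem_cons, List.not_mem_nil, or_false, not_or]
    grind

end SimpleGraph

theorem corollary2 {V : Type*} [Fintype V] (G : SimpleGraph V) (n : ℕ)
    (hcard : Fintype.card V = n) (hn : 8 ≤ n) (hG : G.IsKConnected 2)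
    (hρ : (n : ℝ) - 4 + 2 / ((n : ℝ) - 4) ≤ G.specRadius) :
    ∃ T : SimpleGraph V, G.IsHIST T := by
  classical
  obtain ⟨s, rfl⟩ : ∃ s, n = s + 3 := ⟨n - 3, by omega⟩
  have hs : 5 ≤ s := by omega
  have hV : 8 ≤ Fintype.card V := by omega
  have hmin : ∀ v, 2 ≤ G.degree v := by
    intro v
    obtain ⟨x, y, hxy, hx, hy⟩ := hG.exists_two_neighbors v
    rw [← G.card_neighborFinset_eq_degree]
    exact Finset.one_lt_card.2 ⟨x, by simpa using hx, y, by simpa using hy, hxy⟩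
  obtain ⟨v, hv⟩ := G.exists_sum_degree_neighbors_ge s hs hcard (by
    have h1 : ((s + 3 : ℕ) : ℝ) - 4 = s - 1 := by
      push_cast
      ring
    rwa [h1] at hρ)
  have hsum := G.le_sum_degree_of_sum s hcard (fun w => by convert hmin w) v hv
  obtain ⟨u', hu'⟩ := G.exists_le_degree_of_sum s hs v hv
  have : Nonempty V := ⟨v⟩
  obtain ⟨u, -, hmax⟩ := Finset.exists_max_image Finset.univ (fun z => G.degree z)
    Finset.univ_nonempty
  replace hmax : ∀ z, G.degree z ≤ G.degree u := fun z => hmax z (Finset.mem_univ z)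
  have hsu : s ≤ G.degree u := le_trans (by convert hu') (hmax u')
  set M := (insert u (G.neighborFinset u))ᶜ with hM
  have hMmem : ∀ z, z ∈ M ↔ z ≠ u ∧ ¬ G.Adj u z := by
    intro z
    simp [hM]
  have hMc : G.degree u + 1 + M.card = s + 3 := by
    have h1 : (insert u (G.neighborFinset u)).card + M.card = Fintype.card V :=
      Finset.card_add_card_compl _
    rwa [Finset.card_insert_of_notMem (by simp), G.card_neighborFinset_eq_degree, hcard] at h1
  -- `M` is the set of non-neighbours of `u`; it has `s + 2 - deg u ≤ 2` elements.
  have hM2 : M.card = 0 ∨ M.card = 1 ∨ M.card = 2 := by omega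
  rcases hM2 with h0 | h1 | h2
  · rw [Finset.card_eq_zero] at h0
    refine G.exists_isHIST_of_star hV u fun z hz => ?_
    by_contra hzu
    have := (hMmem z).2 ⟨hz, hzu⟩
    rw [h0] at this
    exact Finset.notMem_empty z this
  · obtain ⟨w, hw⟩ := Finset.card_eq_one.1 h1
    have hwM := (hMmem w).1 (by simp [hw])
    refine G.exists_isHIST_of_one_missing s hs hcard (fun w => by convert hmin w) hsum u w hwM.1
      hwM.2 fun z hz hzw => ?_
    by_contra hzu
    have := (hMmem z).2 ⟨hz, hzu⟩
    rw [hw, Finset.mem_singleton] at this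
    exact hzw this
  · obtain ⟨w₁, w₂, hne, hw⟩ := Finset.card_eq_two.1 h2
    have hw₁ := (hMmem w₁).1 (by simp [hw])
    have hw₂ := (hMmem w₂).1 (by simp [hw])
    have hu : ∀ z, z ≠ u → z ≠ w₁ → z ≠ w₂ → G.Adj u z := by
      intro z hz hz1 hz2
      by_contra hzu
      have := (hMmem z).2 ⟨hz, hzu⟩
      rw [hw, Finset.mem_insert, Finset.mem_singleton] at this
      tauto
    have hdu : G.degree u = s := by omega
    by_contra hno
    have h := G.twoMissing_of_forall_not_isHIST hV hno hne hw₁.1 hw₂.1 hw₁.2 hw₂.2 hu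
    have hsum' : (G.degree u : ℤ) ^ 2 - G.degree u + 10 ≤ ((∑ w, G.degree w : ℕ) : ℤ) := by
      rw [hdu]
      push_cast
      convert hsum
    have hdu' : 5 ≤ G.degree u := by omega
    by_cases hw : G.Adj w₁ w₂
    · refine h.false_of_adj (by convert hdu') (fun z => by convert hmax z) hw
        (by convert hmin w₁) (by convert hmin w₂)
        (G.eq_of_no_deep_broom hV hno hne hw₂.1 hw₁.2 hw₂.2 hu hw)
        (G.eq_of_no_deep_broom hV hno hne.symm hw₁.1 hw₂.2 hw₁.2
          (fun z h1 h2 h3 => hu z h1 h3 h2) hw.symm) (by convert hsum')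
    · exact h.false_of_not_adj (by convert hdu') (fun z => by convert hmax z) hw
        (by convert hmin w₁) (by convert hmin w₂) (by convert hsum')
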